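/- Let $n\ge 0$ and let $A$ be an $n\times n$ integer matrix all of whose (complex) eigenvalues $\lambda$ satisfy $|\lambda|>1$; let $A^*$ be its transpose. On $L^2(\mathbb{R}^n)$ let $T_kf(x)=f(x-k)$ for $k\in\mathbb{Z}^n$, let $D_Af(x)=|\det A|^{1/2}f(Ax)$, and let $\widehat f(\xi)=\int_{\mathbb{R}^n}f(x)e^{-i\langle x,\xi\rangle}\,dx$ (extended to $L^2$). Let $V_0$ be a closed subspace of $L^2(\mathbb{R}^n)$ which is shift invariant, i.e. $T_kV_0=V_0$ for all $k\in\mathbb{Z}^n$, and refinable, i.e. $V_0\subset D_AV_0$. Let $\Phi\subset V_0$ be a normalized tight frame generator for $V_0$, i.e. for every $f\in V_0$, $$\sum_{\varphi\in\Phi}\sum_{k\in\mathbb{Z}^n}|\langle f, T_k\varphi\rangle|^2=\|f\|^2 .$$ Then for almost every $\xi\in\mathbb{R}^n$ the series $\sum_{\varphi\in\Phi}|\widehat\varphi\,((A^*)^{-j}\xi)|^2$ converges for every integer $j\ge 0$, and $$\Big(\sum_{\varphi\in\Phi}|\widehat\varphi\,((A^*)^{-j}\xi)|^2\Big)_{j\ge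 0}$$ is an increasing (i.e. nondecreasing) sequence of real numbers. -/

import Mathlib

open MeasureTheory
open scoped FourierTransform ENNReal

noncomputable section

/-- The complex Hilbert space `L²(ℝⁿ)`. -/
abbrev L2Space (n : ℕ) : Type :=
  Lp (α := EuclideanSpace ℝ (Fin n)) ℂ 2 volume

/-- A dilation matrix preserving the lattice `ℤⁿ`: an integer matrix all of whose complex
eigenvalues `z` satisfy `|z| > 1`. -/
def IsDilationMatrix {n : ℕ} (A : Matrix (Fin n) (Fin n) ℤ) : Prop :=
  ∀ z ∈ spectrum ℂ (A.map (Int.cast : ℤ → ℂ)), 1 < ‖z‖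

/-- The integer matrix `A`, viewed with real entries. -/
def realMatrix {n : ℕ} (A : Matrix (Fin n) (Fin n) ℤ) : Matrix (Fin n) (Fin n) ℝ :=
  A.map (Int.cast : ℤ → ℝ)

lemma realMatrix_det {n : ℕ} (A : Matrix (Fin n) (Fin n) ℤ) :
    (realMatrix A).det = (A.det : ℝ) :=
  ((Int.castRingHom ℝ).map_det A).symm

lemma IsDilationMatrix.realMatrix_det_ne_zero {n : ℕ} {A : Matrix (Fin n) (Fin n) ℤ}
    (hA : IsDilationMatrix A) : (realMatrix A).det ≠ 0 := by
  intro h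
  have h0 : A.det = 0 := by
    rw [realMatrix_det] at h
    exact_mod_cast h
  have h1 : (A.map (Int.cast : ℤ → ℂ)).det = 0 := by
    have := ((Int.castRingHom ℂ).map_det A).symm
    rw [h0, map_zero] at this
    exact this
  have h2 : (0 : ℂ) ∈ spectrum ℂ (A.map (Int.cast : ℤ → ℂ)) := by
    rw [spectrum.zero_mem_iff, Matrix.isUnit_iff_isUnit_det, h1]
    simp
  have := hA 0 h2
  norm_num at this

/-- The action `x ↦ M x` of a real matrix on `ℝⁿ`. -/
def matVec {n : ℕ} (M : Matrix (Fin n) (Fin n) ℝ) :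
    EuclideanSpace ℝ (Fin n) →ₗ[ℝ] EuclideanSpace ℝ (Fin n) :=
  Matrix.toLpLin 2 2 M

lemma matVec_det {n : ℕ} (M : Matrix (Fin n) (Fin n) ℝ) :
    LinearMap.det (matVec M) = M.det := by
  rw [matVec, Matrix.toLpLin_eq_toLin, LinearMap.det_toLin]

lemma map_matVec_volume {n : ℕ} {M : Matrix (Fin n) (Fin n) ℝ} (hM : M.det ≠ 0) :
    Measure.map (matVec M) (volume : Measure (EuclideanSpace ℝ (Fin n)))
      = ENNReal.ofReal |M.det⁻¹| • volume := by
  have h := Measure.map_linearMap_addHaar_eq_smul_addHaar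
    (volume : Measure (EuclideanSpace ℝ (Fin n))) (f := matVec M) (by rwa [matVec_det])
  rwa [matVec_det] at h

lemma matVec_quasiMeasurePreserving {n : ℕ} {M : Matrix (Fin n) (Fin n) ℝ} (hM : M.det ≠ 0) :
    Measure.QuasiMeasurePreserving (matVec M)
      (volume : Measure (EuclideanSpace ℝ (Fin n))) volume := by
  refine ⟨(LinearMap.continuous_of_finiteDimensional _).measurable, ?_⟩
  rw [map_matVec_volume hM]
  exact Measure.smul_absolutelyContinuous

lemma memLp_comp_matVec {n : ℕ} {M : Matrix (Fin n) (Fin n) ℝ} (hM : M.det ≠ 0)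
    (f : L2Space n) :
    MemLp (fun x => f (matVec M x)) 2 (volume : Measure (EuclideanSpace ℝ (Fin n))) := by
  have h : MemLp f 2 (Measure.map (matVec M)
      (volume : Measure (EuclideanSpace ℝ (Fin n)))) := by
    rw [map_matVec_volume hM]
    exact (Lp.memLp f).smul_measure ENNReal.ofReal_ne_top
  exact h.comp_of_map (LinearMap.continuous_of_finiteDimensional _).measurable.aemeasurable

/-- The dilation operator `(D_A f)(x) = |det A|^{1/2} f(A x)` on `L²(ℝⁿ)`. -/
def dilationOp {n : ℕ} (A : Matrix (Fin n) (Fin n) ℤ) (hA : IsDilationMatrix A) :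
    L2Space n →ₗ[ℂ] L2Space n where
  toFun f := ((memLp_comp_matVec hA.realMatrix_det_ne_zero f).const_smul
    ((Real.sqrt |(realMatrix A).det| : ℝ) : ℂ)).toLp
      (fun x => ((Real.sqrt |(realMatrix A).det| : ℝ) : ℂ) • f (matVec (realMatrix A) x))
  map_add' f g := by
    rw [← MemLp.toLp_add]
    refine MemLp.toLp_congr _ _ ?_
    filter_upwards [(matVec_quasiMeasurePreserving hA.realMatrix_det_ne_zero).ae
      (Lp.coeFn_add f g)] with x hx
    simp only [Pi.add_apply] at hx ⊢
    rw [hx, smul_add]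
  map_smul' c f := by
    rw [RingHom.id_apply, ← MemLp.toLp_const_smul]
    refine MemLp.toLp_congr _ _ ?_
    filter_upwards [(matVec_quasiMeasurePreserving hA.realMatrix_det_ne_zero).ae
      (Lp.coeFn_smul c f)] with x hx
    simp only [Pi.smul_apply] at hx ⊢
    rw [hx, smul_comm]

lemma coeFn_dilationOp {n : ℕ} (A : Matrix (Fin n) (Fin n) ℤ) (hA : IsDilationMatrix A)
    (f : L2Space n) :
    dilationOp A hA f =ᵐ[volume]
      fun x => ((Real.sqrt |(realMatrix A).det| : ℝ) : ℂ) * f (matVec (realMatrix A) x) :=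
  MemLp.coeFn_toLp ((memLp_comp_matVec hA.realMatrix_det_ne_zero f).const_smul
    ((Real.sqrt |(realMatrix A).det| : ℝ) : ℂ))

/-- The lattice point `k ∈ ℤⁿ`, viewed in `ℝⁿ`. -/
def latticePoint {n : ℕ} (k : Fin n → ℤ) : EuclideanSpace ℝ (Fin n) :=
  WithLp.toLp 2 (fun i => (k i : ℝ))

/-- The translation operator `(T_k f)(x) = f(x - k)` on `L²(ℝⁿ)`, for `k ∈ ℤⁿ`. -/
def translationOp {n : ℕ} (k : Fin n → ℤ) : L2Space n →ₗ[ℂ] L2Space n :=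
  Lp.compMeasurePreservingₗ ℂ (fun x => x - latticePoint k)
    (measurePreserving_sub_right volume (latticePoint k))

/-- A closed subspace `V` of `L²(ℝⁿ)` is shift invariant if `T_k V = V` for all `k ∈ ℤⁿ`. -/
def IsShiftInvariant {n : ℕ} (V : Submodule ℂ (L2Space n)) : Prop :=
  IsClosed (V : Set (L2Space n)) ∧ ∀ k : Fin n → ℤ, V.map (translationOp k) = V

/-- A family `e` is a normalized tight frame for the subspace `V` of a Hilbert space: it lies in
`V` and `∑ |⟨f, eᵢ⟩|² = ‖f‖²` for all `f ∈ V`. -/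
def IsNormalizedTightFrame {H : Type*} [NormedAddCommGroup H] [InnerProductSpace ℂ H]
    {ι : Type*} (e : ι → H) (V : Submodule ℂ H) : Prop :=
  (∀ i, e i ∈ V) ∧ ∀ f ∈ V, HasSum (fun i => ‖inner ℂ (e i) f‖ ^ 2) (‖f‖ ^ 2)

/-- `Φ ⊆ V` is an NTF generator for `V` if the family `(T_k φ)`, `k ∈ ℤⁿ`, `φ ∈ Φ`, is a
normalized tight frame for `V`. -/
def IsNTFGenerator {n : ℕ} (Φ : Set (L2Space n)) (V : Submodule ℂ (L2Space n)) : Prop :=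
  Φ ⊆ V ∧
    IsNormalizedTightFrame (fun p : (Fin n → ℤ) × Φ => translationOp p.1 (p.2 : L2Space n)) V

/-- `V` is refinable (with respect to `A`) if `V ⊆ D_A V`. -/
def IsRefinable {n : ℕ} (A : Matrix (Fin n) (Fin n) ℤ) (hA : IsDilationMatrix A)
    (V : Submodule ℂ (L2Space n)) : Prop :=
  V ≤ V.map (dilationOp A hA)

/-- The Fourier transform `f̂(ξ) = ∫ f(x) e^{-i⟨x, ξ⟩} dx`, extended to `L²(ℝⁿ)`. Since
`𝓕 f(w) = ∫ f(x) e^{-2πi⟨x, w⟩} dx`, one has `f̂(ξ) = 𝓕 f(ξ / 2π)`. -/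
def hatFun {n : ℕ} (f : L2Space n) (ξ : EuclideanSpace ℝ (Fin n)) : ℂ :=
  (𝓕 f : L2Space n) ((2 * Real.pi)⁻¹ • ξ)

/-- The point `(A*)⁻ʲ ξ`, where `A*` is the transpose of `A`. -/
def adjInvPow {n : ℕ} (A : Matrix (Fin n) (Fin n) ℤ) (j : ℕ)
    (ξ : EuclideanSpace ℝ (Fin n)) : EuclideanSpace ℝ (Fin n) :=
  matVec (((realMatrix A).transpose⁻¹) ^ j) ξ

end

/-! Write σ(w) = ∑_φ |𝓕φ(w)|² (`energyDensity`), B = (A*)⁻¹, and P for the orthogonal projection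
onto V₀. The claim reduces to σ < ∞ and σ ≤ σ ∘ B almost everywhere.

For S inside a unit cube let b_S = 𝓕⁻¹1_S (`bandFun`). The products ⟨b_S, T_kφ⟩ are Fourier
coefficients of 1_S·𝓕φ, so Parseval and the frame identity give ∫_S σ = ‖P b_S‖²
(`IsNTFGenerator.setLIntegral_energyDensity`). Hence σ is locally integrable.

If T = B⁻¹S, refinability writes P b_T = D_A h with h ∈ V₀. Pairing with b_T and applying
Cauchy–Schwarz yields ‖P b_T‖² ≤ |det A| ‖P b_S‖² (`IsRefinable.norm_starProjection_bandFun_le`).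
When S and T both lie in unit cubes, this reads ∫_T σ ≤ |det A| ∫_S σ = ∫_T σ ∘ B. Countably many
such pieces cover space. -/

noncomputable section

/-! ### Unit cubes and Parseval's identity on the torus -/

/-- The half-open unit cube with corner `a`. -/
def unitCube {n : ℕ} (a : Fin n → ℝ) : Set (EuclideanSpace ℝ (Fin n)) :=
  {w | ∀ i, w i ∈ Set.Ioc (a i) (a i + 1)}

lemma measurableSet_unitCube {n : ℕ} (a : Fin n → ℝ) : MeasurableSet (unitCube a) := by
  have : unitCube a = ⋂ i, (fun w : EuclideanSpace ℝ (Fin n) => w i) ⁻¹' Set.Ioc (a i) (a i + 1) := by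
    ext w; simp [unitCube]
  rw [this]
  exact MeasurableSet.iInter fun i => (by fun_prop : Measurable _) measurableSet_Ioc

lemma volume_unitCube {n : ℕ} (a : Fin n → ℝ) : volume (unitCube a) = 1 := by
  have h := (EuclideanSpace.volume_preserving_symm_measurableEquiv_toLp (Fin n)).measure_preimage
    (s := Set.univ.pi fun i => Set.Ioc (a i) (a i + 1))
    (MeasurableSet.univ_pi fun i => measurableSet_Ioc).nullMeasurableSet
  have h2 : unitCube a = (MeasurableEquiv.toLp 2 (Fin n → ℝ)).symm ⁻¹'
      (Set.univ.pi fun i => Set.Ioc (a i) (a i + 1)) := by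
    ext w; simp [unitCube]
  rw [h2, h, Real.volume_pi_Ioc]
  simp

lemma iUnion_unitCube {n : ℕ} :
    ⋃ k : Fin n → ℤ, unitCube (fun i => (k i : ℝ)) = Set.univ := by
  -- The cubes are open on the left, so the corner is the ceiling minus one, not the floor.
  refine Set.eq_univ_of_forall fun w => Set.mem_iUnion.2 ⟨fun i => ⌈w i⌉ - 1, fun i => ?_⟩
  have h1 := Int.ceil_lt_add_one (w i)
  have h2 := Int.le_ceil (w i)
  push_cast
  constructor <;> linarith

local instance : MeasureSpace UnitAddCircle := ⟨AddCircle.haarAddCircle⟩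

-- The sign is the one in the modulation that `𝓕` produces from T_k, so torus coefficients match
-- frame coefficients without reindexing.
open UnitAddTorus in
lemma mFourier_neg_coe {n : ℕ} (k : Fin n → ℤ) (w : EuclideanSpace ℝ (Fin n)) :
    mFourier (-k) (fun i => (w i : UnitAddCircle)) =
      (Real.fourierChar (-(inner ℝ (latticePoint k) w)) : ℂ) := by
  simp only [mFourier, ContinuousMap.coe_mk, Pi.neg_apply, fourier_coe_apply,
    Real.fourierChar_apply, ← Complex.exp_sum, PiLp.inner_apply, latticePoint]
  congr 1
  simp [Finset.mul_sum, Finset.sum_mul]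
  exact Finset.sum_congr rfl fun i _ => by ring

open UnitAddTorus in
/-- Parseval's identity for functions supported in a unit cube. -/
lemma hasSum_sq_setIntegral_fourierChar {n : ℕ} {a : Fin n → ℝ} {E : Set (EuclideanSpace ℝ (Fin n))}
    (hE : MeasurableSet E) (hEa : E ⊆ unitCube a) {u : EuclideanSpace ℝ (Fin n) → ℂ}
    (hu : MemLp u 2 volume) :
    HasSum (fun k : Fin n → ℤ =>
      ‖∫ w in E, (Real.fourierChar (-(inner ℝ (latticePoint k) w)) : ℂ) * u w‖ ^ 2)
      (∫ w in E, ‖u w‖ ^ 2) := by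
  set e := (MeasurableEquiv.toLp 2 (Fin n → ℝ))
  have he : MeasurePreserving e volume volume :=
    (EuclideanSpace.volume_preserving_symm_measurableEquiv_toLp (Fin n)).symm
  set Q : Set (Fin n → ℝ) := {x | ∀ i, x i ∈ Set.Ioc (a i) (a i + 1)}
  have hQ : MeasurableSet Q := MeasurableSet.univ_pi' fun i => measurableSet_Ioc
  set g : (Fin n → ℝ) → ℂ := fun x => E.indicator u (e x)
  have hg : MemLp g 2 volume := (hu.indicator hE).comp_measurePreserving he
  -- The 1-periodization of u·1_E, read off on the cube with corner `a`.
  set F : UnitAddTorus (Fin n) → ℂ := fun t => g (measurableEquivPiIoc a t).1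
  have hF : MemLp F 2 volume :=
    ((hg.restrict Q).comp_measurePreserving
      (measurePreserving_subtype_coe hQ)).comp_measurePreserving (measurePreserving_equivPiIoc a)
  have hFx : ∀ x ∈ Q, F (fun i => (x i : UnitAddCircle)) = g x := by
    intro x hx
    simp only [F]
    congr 1
    exact congrArg Subtype.val ((measurableEquivPiIoc a).apply_symm_apply ⟨x, hx⟩)
  have key : ∀ {G : Type} [NormedAddCommGroup G] [NormedSpace ℝ G] (h : EuclideanSpace ℝ (Fin n) → G),
      (∀ w ∉ E, h w = 0) → ∫ x in Q, h (e x) = ∫ w in E, h w := by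
    intro G _ _ h h0
    have h1 : Q = e ⁻¹' (unitCube a) := rfl
    rw [h1, he.setIntegral_preimage_emb e.measurableEmbedding]
    exact (setIntegral_eq_of_subset_of_forall_sdiff_eq_zero (measurableSet_unitCube a) hEa
      fun w hw => h0 w hw.2)
  have h := hasSum_sq_mFourierCoeff (hF.toLp F)
  have hc : ∀ k, mFourierCoeff (hF.toLp F) k =
      ∫ w in E, (Real.fourierChar (-(inner ℝ (latticePoint k) w)) : ℂ) * u w := by
    intro k
    have h1 : mFourierCoeff (hF.toLp F) k = mFourierCoeff F k := by
      refine integral_congr_ae ?_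
      filter_upwards [hF.coeFn_toLp] with t ht
      rw [ht]
    rw [h1, mFourierCoeff_eq_integral _ _ a]
    rw [setIntegral_congr_fun (g := fun x => (Real.fourierChar (-(inner ℝ (latticePoint k) (e x))) : ℂ)
      * E.indicator u (e x)) hQ (fun x hx => ?_)]
    · rw [key (fun w => (Real.fourierChar (-(inner ℝ (latticePoint k) w)) : ℂ) * E.indicator u w)
        (fun w hw => by simp [hw])]
      exact setIntegral_congr_fun hE fun w hw => by simp [hw]
    · simp only [smul_eq_mul]
      rw [hFx x hx, ← mFourier_neg_coe]
      rfl
  have hn : ∫ t, ‖hF.toLp F t‖ ^ 2 = ∫ w in E, ‖u w‖ ^ 2 := by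
    have h1 : ∫ t, ‖hF.toLp F t‖ ^ 2 = ∫ t, ‖F t‖ ^ 2 := by
      refine integral_congr_ae ?_
      filter_upwards [hF.coeFn_toLp] with t ht
      rw [ht]
    rw [h1, integral_preimage _ a]
    rw [setIntegral_congr_fun (g := fun x => ‖E.indicator u (e x)‖ ^ 2) hQ (fun x hx => ?_)]
    · rw [key (fun w => ‖E.indicator u w‖ ^ 2) (fun w hw => by simp [hw])]
      exact setIntegral_congr_fun hE fun w hw => by simp [hw]
    · simp only
      rw [hFx x hx]
  simpa only [hc, hn] using h

/-! ### Translations on the Fourier side -/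

lemma norm_translationOp {n : ℕ} (k : Fin n → ℤ) (f : L2Space n) :
    ‖translationOp k f‖ = ‖f‖ :=
  Lp.norm_compMeasurePreserving f _

lemma continuous_translationOp {n : ℕ} (k : Fin n → ℤ) :
    Continuous (translationOp (n := n) k) :=
  AddMonoidHomClass.continuous_of_bound (translationOp k) 1
    fun f => by rw [norm_translationOp, one_mul]

lemma translationOp_zero {n : ℕ} (f : L2Space n) : translationOp 0 f = f := by
  refine Lp.ext ?_
  refine (Lp.coeFn_compMeasurePreserving f _).trans ?_
  filter_upwards with x
  have : latticePoint (0 : Fin n → ℤ) = 0 := by ext i; simp [latticePoint]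
  simp [this]

/-- Integration over `E` against a bounded weight is continuous on `L²`. -/
lemma continuous_setIntegral_mul {n : ℕ} {E : Set (EuclideanSpace ℝ (Fin n))}
    (hE : MeasurableSet E) (hEf : volume E ≠ ∞) {c : EuclideanSpace ℝ (Fin n) → ℂ}
    (hc : Continuous c) (hc1 : ∀ w, ‖c w‖ ≤ 1) :
    Continuous fun f : L2Space n => ∫ w in E, c w * f w := by
  -- The conjugate appears because `inner` is conjugate-linear in its first argument.
  have hm : MemLp (E.indicator fun w => star (c w)) 2 volume := by
    rw [memLp_indicator_iff_restrict hE]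
    have : IsFiniteMeasure (volume.restrict E) := ⟨by simpa using hEf.lt_top⟩
    exact MemLp.of_bound (by fun_prop) 1 (by simpa using Filter.Eventually.of_forall hc1)
  have h : (fun f : L2Space n => ∫ w in E, c w * f w) = fun f => inner ℂ (hm.toLp _) f := by
    funext f
    rw [L2.inner_def, ← integral_indicator hE]
    refine integral_congr_ae ?_
    filter_upwards [hm.coeFn_toLp] with w hw
    rw [hw]
    by_cases h : w ∈ E <;> simp [h, mul_comm]
  rw [h]
  fun_prop

/-- The Fourier transform turns translations into modulations. -/
lemma setIntegral_fourier_translationOp {n : ℕ} {E : Set (EuclideanSpace ℝ (Fin n))}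
    (hE : MeasurableSet E) (hEf : volume E ≠ ∞) (k : Fin n → ℤ) (f : L2Space n) :
    ∫ w in E, (𝓕 (translationOp k f) : L2Space n) w =
      ∫ w in E, (Real.fourierChar (-(inner ℝ (latticePoint k) w)) : ℂ) * (𝓕 f : L2Space n) w := by
  have hF : Continuous fun f : L2Space n => (𝓕 f : L2Space n) :=
    (Lp.fourierTransformₗᵢ (EuclideanSpace ℝ (Fin n)) ℂ).continuous
  -- Both sides, integrated over a set of finite measure, are continuous in f ∈ L², so Schwartz
  -- functions suffice.
  refine DenseRange.induction_on (p := fun f : L2Space n =>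
    ∫ w in E, (𝓕 (translationOp k f) : L2Space n) w =
      ∫ w in E, (Real.fourierChar (-(inner ℝ (latticePoint k) w)) : ℂ) * (𝓕 f : L2Space n) w)
    (SchwartzMap.denseRange_toLpCLM (p := 2) ENNReal.ofNat_ne_top) f ?_ ?_
  · refine isClosed_eq ?_ ?_
    · have := (continuous_setIntegral_mul hE hEf (c := fun _ => 1) continuous_const (by simp)).comp
        (hF.comp (continuous_translationOp k))
      simpa [Function.comp_def] using this
    · exact (continuous_setIntegral_mul hE hEf (by fun_prop)
        (fun w => (Circle.norm_coe _).le)).comp hF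
  · intro f
    have h1 : translationOp k (f.toLp 2) = (f.compSubConstCLM ℂ (latticePoint k)).toLp 2 := by
      refine Lp.ext ?_
      refine (Lp.coeFn_compMeasurePreserving _ _).trans ?_
      refine Filter.EventuallyEq.trans ?_ (SchwartzMap.coeFn_toLp _ _ _).symm
      exact (measurePreserving_sub_right volume (latticePoint k)).quasiMeasurePreserving.ae_eq_comp
        (f.coeFn_toLp 2 volume)
    rw [SchwartzMap.toLpCLM_apply, h1, SchwartzMap.toLp_fourier_eq, SchwartzMap.toLp_fourier_eq]
    refine setIntegral_congr_ae hE ?_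
    filter_upwards [(𝓕 f).coeFn_toLp 2 volume,
      (𝓕 (f.compSubConstCLM ℂ (latticePoint k))).coeFn_toLp 2 volume] with w h1 h2 _
    rw [h1, h2, SchwartzMap.fourier_coe, SchwartzMap.fourier_coe]
    have := congrFun (VectorFourier.fourierIntegral_comp_add_right Real.fourierChar volume
      (innerₗ (EuclideanSpace ℝ (Fin n))) f (-latticePoint k)) w
    simp only [map_neg, LinearMap.neg_apply, innerₗ_apply_apply, Function.comp_def,
      ← sub_eq_add_neg, Circle.smul_def, smul_eq_mul] at this
    exact this

/-! ### Linear changes of variables and dilations -/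

/-- The action of an invertible matrix as a continuous linear equivalence. -/
def matVecEquiv {n : ℕ} {M : Matrix (Fin n) (Fin n) ℝ} (hM : M.det ≠ 0) :
    EuclideanSpace ℝ (Fin n) ≃L[ℝ] EuclideanSpace ℝ (Fin n) :=
  (LinearEquiv.ofLinearMap (matVec M) (matVec M⁻¹)
    (by rw [matVec, matVec, ← Matrix.toLpLin_mul, Matrix.mul_nonsing_inv _ hM.isUnit,
      Matrix.toLpLin_one])
    (by rw [matVec, matVec, ← Matrix.toLpLin_mul, Matrix.nonsing_inv_mul _ hM.isUnit,
      Matrix.toLpLin_one])).toContinuousLinearEquiv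

lemma measurable_matVec {n : ℕ} (M : Matrix (Fin n) (Fin n) ℝ) : Measurable (matVec M) :=
  (LinearMap.continuous_of_finiteDimensional _).measurable

lemma measurableEmbedding_matVec {n : ℕ} {M : Matrix (Fin n) (Fin n) ℝ} (hM : M.det ≠ 0) :
    MeasurableEmbedding (matVec M) :=
  (matVecEquiv hM).toHomeomorph.measurableEmbedding

lemma matVec_mul {n : ℕ} (M N : Matrix (Fin n) (Fin n) ℝ) (x : EuclideanSpace ℝ (Fin n)) :
    matVec (M * N) x = matVec M (matVec N x) := by
  rw [matVec, Matrix.toLpLin_mul 2 2 2]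
  rfl

lemma matVec_one {n : ℕ} (x : EuclideanSpace ℝ (Fin n)) : matVec 1 x = x := by
  rw [matVec, Matrix.toLpLin_one]
  rfl

lemma inner_matVec_left {n : ℕ} (M : Matrix (Fin n) (Fin n) ℝ) (x y : EuclideanSpace ℝ (Fin n)) :
    inner ℝ (matVec M x) y = inner ℝ x (matVec M.transpose y) := by
  simp only [matVec, EuclideanSpace.inner_eq_star_dotProduct, Matrix.toLpLin_apply, star_trivial]
  rw [Matrix.dotProduct_mulVec, Matrix.mulVec_transpose]

lemma setIntegral_comp_matVec {n : ℕ} {G : Type*} [NormedAddCommGroup G] [NormedSpace ℝ G]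
    {M : Matrix (Fin n) (Fin n) ℝ} (hM : M.det ≠ 0)
    (S : Set (EuclideanSpace ℝ (Fin n))) (g : EuclideanSpace ℝ (Fin n) → G) :
    ∫ x in matVec M ⁻¹' S, g (matVec M x) = |M.det|⁻¹ • ∫ x in S, g x := by
  rw [← (measurableEmbedding_matVec hM).setIntegral_map, map_matVec_volume hM,
    Measure.restrict_smul, integral_smul_measure, ENNReal.toReal_ofReal (abs_nonneg _), abs_inv]

lemma setLIntegral_comp_matVec {n : ℕ} {M : Matrix (Fin n) (Fin n) ℝ} (hM : M.det ≠ 0)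
    {S : Set (EuclideanSpace ℝ (Fin n))} (hS : MeasurableSet S)
    {g : EuclideanSpace ℝ (Fin n) → ℝ≥0∞} (hg : Measurable g) :
    ∫⁻ x in matVec M ⁻¹' S, g (matVec M x) = ENNReal.ofReal |M.det|⁻¹ * ∫⁻ x in S, g x := by
  rw [← setLIntegral_map hS hg (measurable_matVec M), map_matVec_volume hM,
    Measure.restrict_smul, lintegral_smul_measure, abs_inv, smul_eq_mul]

lemma volume_preimage_matVec_ne_top {n : ℕ} {M : Matrix (Fin n) (Fin n) ℝ} (hM : M.det ≠ 0)
    {S : Set (EuclideanSpace ℝ (Fin n))} (hS : MeasurableSet S) (hSf : volume S ≠ ∞) :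
    volume (matVec M ⁻¹' S) ≠ ∞ := by
  rw [← Measure.map_apply (measurable_matVec M) hS, map_matVec_volume hM]
  exact ENNReal.mul_ne_top ENNReal.ofReal_ne_top hSf

lemma det_transpose_inv_ne_zero {n : ℕ} {M : Matrix (Fin n) (Fin n) ℝ} (hM : M.det ≠ 0) :
    (M.transpose⁻¹).det ≠ 0 := by
  rw [Matrix.det_nonsing_inv, Matrix.det_transpose]
  simpa using hM

/-- The Fourier transform of a function composed with a linear map. -/
lemma fourier_comp_matVec {n : ℕ} {M : Matrix (Fin n) (Fin n) ℝ} (hM : M.det ≠ 0)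
    (f : EuclideanSpace ℝ (Fin n) → ℂ) (w : EuclideanSpace ℝ (Fin n)) :
    𝓕 (fun x => f (matVec M x)) w = |M.det|⁻¹ • 𝓕 f (matVec (M.transpose⁻¹) w) := by
  rw [Real.fourier_eq, Real.fourier_eq]
  have h := setIntegral_comp_matVec hM Set.univ
    (fun y => Real.fourierChar (-(inner ℝ y (matVec (M.transpose⁻¹) w))) • f y)
  rw [Set.preimage_univ, Measure.restrict_univ] at h
  rw [← h]
  congr with x
  rw [inner_matVec_left, ← matVec_mul, Matrix.mul_nonsing_inv _
    (by rw [Matrix.det_transpose]; exact hM.isUnit), matVec_one]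

/-- The factor |det A|^{1/2} is chosen to cancel the Jacobian. -/
lemma norm_dilationOp {n : ℕ} {A : Matrix (Fin n) (Fin n) ℤ} (hA : IsDilationMatrix A)
    (f : L2Space n) : ‖dilationOp A hA f‖ = ‖f‖ := by
  have hd := hA.realMatrix_det_ne_zero
  have h (g : L2Space n) : ‖g‖ ^ 2 = ∫ x, ‖g x‖ ^ 2 := by
    rw [← inner_self_eq_norm_sq (𝕜 := ℂ), L2.inner_def, ← integral_re (L2.integrable_inner g g)]
    simp only [inner_self_eq_norm_sq]
  rw [← sq_eq_sq₀ (norm_nonneg _) (norm_nonneg _), h, h]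
  have h1 : ∫ x, ‖dilationOp A hA f x‖ ^ 2 =
      ∫ x, |(realMatrix A).det| * ‖f (matVec (realMatrix A) x)‖ ^ 2 := by
    refine integral_congr_ae ?_
    filter_upwards [coeFn_dilationOp A hA f] with x hx
    rw [hx, norm_mul, mul_pow, Complex.norm_real, Real.norm_eq_abs, sq_abs,
      Real.sq_sqrt (abs_nonneg _)]
  have h2 := setIntegral_comp_matVec hd Set.univ (fun y => ‖f y‖ ^ 2)
  rw [Set.preimage_univ, Measure.restrict_univ] at h2
  rw [h1, integral_const_mul, h2, smul_eq_mul, mul_inv_cancel_left₀ (abs_ne_zero.2 hd)]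

lemma continuous_dilationOp {n : ℕ} {A : Matrix (Fin n) (Fin n) ℤ} (hA : IsDilationMatrix A) :
    Continuous (dilationOp A hA) :=
  AddMonoidHomClass.continuous_of_bound (dilationOp A hA) 1
    fun f => by rw [norm_dilationOp, one_mul]

/-- The Fourier transform turns the dilation by `A` into the dilation by `(A*)⁻¹`. -/
lemma setIntegral_fourier_dilationOp {n : ℕ} {A : Matrix (Fin n) (Fin n) ℤ}
    (hA : IsDilationMatrix A) {S : Set (EuclideanSpace ℝ (Fin n))}
    (hS : MeasurableSet S) (hSf : volume S ≠ ∞) (f : L2Space n) :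
    ∫ w in matVec ((realMatrix A).transpose⁻¹) ⁻¹' S, (𝓕 (dilationOp A hA f) : L2Space n) w =
      (Real.sqrt |(realMatrix A).det| : ℂ) * ∫ w in S, (𝓕 f : L2Space n) w := by
  have hd := hA.realMatrix_det_ne_zero
  have hB := det_transpose_inv_ne_zero hd
  have hBS := measurable_matVec ((realMatrix A).transpose⁻¹) hS
  have hF : Continuous fun f : L2Space n => (𝓕 f : L2Space n) :=
    (Lp.fourierTransformₗᵢ (EuclideanSpace ℝ (Fin n)) ℂ).continuous
  have hI {E : Set (EuclideanSpace ℝ (Fin n))} (hE : MeasurableSet E) (hEf : volume E ≠ ∞) :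
      Continuous fun f : L2Space n => ∫ w in E, f w := by
    simpa using continuous_setIntegral_mul hE hEf (c := fun _ => 1) continuous_const (by simp)
  refine DenseRange.induction_on (p := fun f : L2Space n =>
    ∫ w in matVec ((realMatrix A).transpose⁻¹) ⁻¹' S, (𝓕 (dilationOp A hA f) : L2Space n) w =
      (Real.sqrt |(realMatrix A).det| : ℂ) * ∫ w in S, (𝓕 f : L2Space n) w)
    (SchwartzMap.denseRange_toLpCLM (p := 2) ENNReal.ofNat_ne_top) f ?_ ?_
  · refine isClosed_eq ?_ (continuous_const.mul ((hI hS hSf).comp hF))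
    exact (hI hBS (volume_preimage_matVec_ne_top hB hS hSf)).comp
      (hF.comp (continuous_dilationOp hA))
  · intro f
    set g : SchwartzMap (EuclideanSpace ℝ (Fin n)) ℂ :=
      SchwartzMap.compCLMOfContinuousLinearEquiv ℂ (matVecEquiv hd) f with hg
    have h1 : dilationOp A hA (f.toLp 2 volume) =
        (Real.sqrt |(realMatrix A).det| : ℂ) • g.toLp 2 volume := by
      refine Lp.ext ?_
      filter_upwards [coeFn_dilationOp A hA (f.toLp 2 volume),
        Lp.coeFn_smul (Real.sqrt |(realMatrix A).det| : ℂ) (g.toLp 2 volume), g.coeFn_toLp 2 volume,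
        (matVec_quasiMeasurePreserving hd).ae_eq_comp (f.coeFn_toLp 2 volume)] with x h1 h2 h3 h4
      rw [h1, h2, Pi.smul_apply, h3, smul_eq_mul]
      exact congrArg _ h4
    rw [SchwartzMap.toLpCLM_apply, h1, FourierTransform.fourier_smul, SchwartzMap.toLp_fourier_eq,
      SchwartzMap.toLp_fourier_eq]
    have h2 : ∫ w in matVec ((realMatrix A).transpose⁻¹) ⁻¹' S,
        ((Real.sqrt |(realMatrix A).det| : ℂ) • (𝓕 g).toLp 2 volume : L2Space n) w =
        ∫ w in matVec ((realMatrix A).transpose⁻¹) ⁻¹' S, (Real.sqrt |(realMatrix A).det| : ℂ) *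
          (|(realMatrix A).det|⁻¹ • (𝓕 f) (matVec ((realMatrix A).transpose⁻¹) w)) := by
      refine setIntegral_congr_ae hBS ?_
      filter_upwards [Lp.coeFn_smul (Real.sqrt |(realMatrix A).det| : ℂ) ((𝓕 g).toLp 2 volume),
        (𝓕 g).coeFn_toLp 2 volume] with w h2 h3 _
      rw [h2, Pi.smul_apply, h3, smul_eq_mul, SchwartzMap.fourier_coe, SchwartzMap.fourier_coe,
        ← fourier_comp_matVec hd]
      rfl
    have h3 : ∫ w in S, ((𝓕 f).toLp 2 volume : L2Space n) w = ∫ w in S, (𝓕 f) w := by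
      refine setIntegral_congr_ae hS ?_
      filter_upwards [(𝓕 f).coeFn_toLp 2 volume] with w h3 _ using h3
    -- The Jacobian |det B|⁻¹ = |det A| cancels the |det A|⁻¹ from the Fourier transform, leaving
    -- only the square root.
    rw [h2, h3, integral_const_mul, integral_smul, setIntegral_comp_matVec hB, smul_smul,
      Matrix.det_nonsing_inv, Matrix.det_transpose, Ring.inverse_eq_inv', abs_inv, inv_inv,
      inv_mul_cancel₀ (abs_ne_zero.2 hd), one_smul]

/-! ### Band-limited test functions and frame projections -/

/-- The `L²` function whose Fourier transform is the indicator function of `S`. -/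
def bandFun {n : ℕ} {S : Set (EuclideanSpace ℝ (Fin n))} (hS : MeasurableSet S)
    (hSf : volume S ≠ ∞) : L2Space n :=
  𝓕⁻ (indicatorConstLp 2 hS hSf (1 : ℂ))

/-- Plancherel turns integrals of `𝓕 f` into inner products, to which projections apply. -/
lemma inner_bandFun {n : ℕ} {S : Set (EuclideanSpace ℝ (Fin n))} (hS : MeasurableSet S)
    (hSf : volume S ≠ ∞) (f : L2Space n) :
    inner ℂ (bandFun hS hSf) f = ∫ w in S, (𝓕 f : L2Space n) w := by
  rw [← Lp.inner_fourier_eq, bandFun, FourierTransform.fourier_fourierInv_eq,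
    L2.inner_indicatorConstLp_one]

/-- A normalized tight frame for `V` computes the norm of the orthogonal projection onto `V`. -/
lemma IsNormalizedTightFrame.hasSum_starProjection {H : Type*} [NormedAddCommGroup H]
    [InnerProductSpace ℂ H] {ι : Type*} {e : ι → H} {V : Submodule ℂ H}
    [V.HasOrthogonalProjection] (he : IsNormalizedTightFrame e V) (f : H) :
    HasSum (fun i => ‖inner ℂ (e i) f‖ ^ 2) (‖V.starProjection f‖ ^ 2) := by
  have h := he.2 (V.starProjection f) (V.starProjection_apply_mem f)
  convert h using 4 with i
  rw [← Submodule.inner_starProjection_left_eq_right, V.starProjection_eq_self_iff.2 (he.1 i)]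

/-- The nonzero vectors of a normalized tight frame in a separable Hilbert space are indexed by
a countable set. -/
lemma IsNormalizedTightFrame.countable_ne_zero {H : Type*} [NormedAddCommGroup H]
    [InnerProductSpace ℂ H] [TopologicalSpace.SeparableSpace H] {ι : Type*} {e : ι → H}
    {V : Submodule ℂ H} [V.HasOrthogonalProjection] (he : IsNormalizedTightFrame e V) :
    {i | e i ≠ 0}.Countable := by
  -- Summability leaves countably many nonzero coefficients against each dense vector; any other
  -- frame vector is orthogonal to a dense set.
  have h (m : ℕ) : (Function.support fun i =>
      ‖inner ℂ (e i) (TopologicalSpace.denseSeq H m)‖ ^ 2).Countable :=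
    (he.hasSum_starProjection _).summable.countable_support
  refine (Set.countable_iUnion h).mono fun i hi => ?_
  by_contra hc
  simp only [Set.mem_iUnion, Function.mem_support, not_exists, not_not] at hc
  refine hi ?_
  have h0 : ∀ x, inner ℂ (e i) x = 0 := by
    have := (TopologicalSpace.denseRange_denseSeq H).equalizer
      (g := fun x => inner ℂ (e i) x) (h := fun _ => (0 : ℂ)) (by fun_prop) (by fun_prop)
      (funext fun m => by simpa using hc m)
    exact congrFun this
  exact inner_self_eq_zero.1 (h0 _)

/-- Needed for measurability of `energyDensity` and for exchanging sum and integral. -/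
lemma IsNTFGenerator.countable {n : ℕ} {Φ : Set (L2Space n)} {V : Submodule ℂ (L2Space n)}
    [V.HasOrthogonalProjection] (hΦ : IsNTFGenerator Φ V) : Φ.Countable := by
  have : Fact ((2 : ℝ≥0∞) ≠ ∞) := ⟨ENNReal.ofNat_ne_top⟩
  have h := hΦ.2.countable_ne_zero.image fun p => (p.2 : L2Space n)
  refine (h.insert 0).mono fun φ hφ => ?_
  by_cases h0 : φ = 0
  · exact Or.inl h0
  · exact Or.inr ⟨(0, ⟨φ, hφ⟩), by simpa [translationOp_zero] using h0, rfl⟩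

/-! ### The energy density and its monotonicity -/

/-- The sum of the squared moduli of the Fourier transforms of the elements of `Φ`. -/
def energyDensity {n : ℕ} (Φ : Set (L2Space n)) (w : EuclideanSpace ℝ (Fin n)) : ℝ≥0∞ :=
  ∑' φ : Φ, ‖(𝓕 (φ : L2Space n) : L2Space n) w‖ₑ ^ 2

lemma measurable_enorm_sq_Lp {n : ℕ} (f : L2Space n) : Measurable fun w => ‖f w‖ₑ ^ 2 :=
  ((Lp.stronglyMeasurable f).measurable.enorm).pow_const 2

lemma measurable_energyDensity {n : ℕ} {Φ : Set (L2Space n)} (hΦ : Φ.Countable) :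
    Measurable (energyDensity Φ) := by
  have := hΦ.to_subtype
  exact Measurable.tsum fun φ => measurable_enorm_sq_Lp _

/-- Over subsets of a unit cube, the energy density integrates to the squared norm of the
projection of the band-limited function. -/
lemma IsNTFGenerator.setLIntegral_energyDensity {n : ℕ} {Φ : Set (L2Space n)}
    {V : Submodule ℂ (L2Space n)} [V.HasOrthogonalProjection] (hΦ : IsNTFGenerator Φ V)
    {a : Fin n → ℝ} {S : Set (EuclideanSpace ℝ (Fin n))} (hS : MeasurableSet S)
    (hSf : volume S ≠ ∞) (hSa : S ⊆ unitCube a) :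
    ∫⁻ w in S, energyDensity Φ w =
      ENNReal.ofReal (‖V.starProjection (bandFun hS hSf)‖ ^ 2) := by
  have := hΦ.countable.to_subtype
  have h := hΦ.2.hasSum_starProjection (bandFun hS hSf)
  rw [← h.tsum_eq, ENNReal.ofReal_tsum_of_nonneg (fun _ => by positivity) h.summable,
    ENNReal.tsum_prod', ENNReal.tsum_comm]
  simp only [energyDensity]
  rw [lintegral_tsum fun φ => (measurable_enorm_sq_Lp _).aemeasurable]
  refine tsum_congr fun φ => ?_
  have hp := hasSum_sq_setIntegral_fourierChar hS hSa (Lp.memLp (𝓕 (φ : L2Space n) : L2Space n))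
  have hk (k : Fin n → ℤ) : ‖inner ℂ (translationOp k (φ : L2Space n)) (bandFun hS hSf)‖ =
      ‖∫ w in S, (Real.fourierChar (-(inner ℝ (latticePoint k) w)) : ℂ) *
        (𝓕 (φ : L2Space n) : L2Space n) w‖ := by
    rw [norm_inner_symm, inner_bandFun, setIntegral_fourier_translationOp hS hSf]
  simp only [hk]
  rw [← ENNReal.ofReal_tsum_of_nonneg (fun _ => by positivity) hp.summable, hp.tsum_eq,
    ofReal_integral_eq_lintegral_ofReal ?_ (Filter.Eventually.of_forall fun _ => by positivity)]
  · refine lintegral_congr fun w => ?_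
    rw [ENNReal.ofReal_pow (norm_nonneg _), ofReal_norm]
  · exact ((Lp.memLp _).integrable_norm_pow (by norm_num)).integrableOn

/-- Refinability compares the projections of a band-limited function and of its dilation. -/
lemma IsRefinable.norm_starProjection_bandFun_le {n : ℕ} {A : Matrix (Fin n) (Fin n) ℤ}
    {hA : IsDilationMatrix A} {V : Submodule ℂ (L2Space n)} [V.HasOrthogonalProjection]
    (hV : IsRefinable A hA V) {S : Set (EuclideanSpace ℝ (Fin n))} (hS : MeasurableSet S)
    (hSf : volume S ≠ ∞) (hT : MeasurableSet (matVec ((realMatrix A).transpose⁻¹) ⁻¹' S))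
    (hTf : volume (matVec ((realMatrix A).transpose⁻¹) ⁻¹' S) ≠ ∞) :
    ‖V.starProjection (bandFun hT hTf)‖ ^ 2 ≤
      |(realMatrix A).det| * ‖V.starProjection (bandFun hS hSf)‖ ^ 2 := by
  set g := V.starProjection (bandFun hT hTf) with hg
  -- Refinability enters here: `g` = D_A `h` with `h` ∈ V.
  obtain ⟨h, hh, hhg⟩ := hV (V.starProjection_apply_mem (bandFun hT hTf))
  have hproj {f k : L2Space n} (hk : k ∈ V) : inner ℂ f k = inner ℂ (V.starProjection f) k := by
    rw [Submodule.inner_starProjection_left_eq_right, V.starProjection_eq_self_iff.2 hk]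
  have hn : ‖h‖ = ‖g‖ := by rw [hg, ← hhg, norm_dilationOp]
  have h1 : ‖g‖ ^ 2 ≤ Real.sqrt |(realMatrix A).det| *
      (‖V.starProjection (bandFun hS hSf)‖ * ‖g‖) := by
    calc ‖g‖ ^ 2 = ‖inner ℂ g g‖ := by
          rw [inner_self_eq_norm_sq_to_K, norm_pow]; simp
      _ = ‖inner ℂ (bandFun hT hTf) g‖ := 
          congrArg norm (hproj (V.starProjection_apply_mem (bandFun hT hTf))).symm
      _ = ‖(Real.sqrt |(realMatrix A).det| : ℂ) * inner ℂ (bandFun hS hSf) h‖ := by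
          rw [hg, ← hhg, inner_bandFun, setIntegral_fourier_dilationOp hA hS hSf, inner_bandFun]
      _ = Real.sqrt |(realMatrix A).det| * ‖inner ℂ (V.starProjection (bandFun hS hSf)) h‖ := by
          rw [norm_mul, Complex.norm_real, Real.norm_of_nonneg (Real.sqrt_nonneg _), hproj hh]
      _ ≤ _ := by
          rw [← hn]
          gcongr
          exact norm_inner_le_norm _ _
  have h2 : ‖g‖ ≤ Real.sqrt |(realMatrix A).det| * ‖V.starProjection (bandFun hS hSf)‖ := by
    rcases (norm_nonneg g).eq_or_lt with h0 | h0
    · rw [← h0]; positivity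
    · refine le_of_mul_le_mul_right ?_ h0
      rw [← sq, mul_assoc]
      exact h1
  calc ‖g‖ ^ 2 ≤ (Real.sqrt |(realMatrix A).det| * ‖V.starProjection (bandFun hS hSf)‖) ^ 2 := by
        gcongr
    _ = _ := by rw [mul_pow, Real.sq_sqrt (abs_nonneg _)]

lemma ae_of_forall_restrict_unitCube {n : ℕ} {p : EuclideanSpace ℝ (Fin n) → Prop}
    (h : ∀ k : Fin n → ℤ, ∀ᵐ w ∂volume.restrict (unitCube fun i => (k i : ℝ)), p w) :
    ∀ᵐ w, p w := by
  rw [← Measure.restrict_univ (μ := volume), ← iUnion_unitCube, ae_restrict_iUnion_iff]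
  exact h

/-- The integral over each lattice cube is a squared norm, hence finite. -/
lemma IsNTFGenerator.ae_energyDensity_lt_top {n : ℕ} {Φ : Set (L2Space n)}
    {V : Submodule ℂ (L2Space n)} [V.HasOrthogonalProjection] (hΦ : IsNTFGenerator Φ V) :
    ∀ᵐ w, energyDensity Φ w < ∞ := by
  refine ae_of_forall_restrict_unitCube fun k => ?_
  refine ae_lt_top (measurable_energyDensity hΦ.countable) ?_
  rw [hΦ.setLIntegral_energyDensity (measurableSet_unitCube _) (by simp [volume_unitCube])
    subset_rfl]
  exact ENNReal.ofReal_ne_top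

/-- The energy density increases along the dilation `(A*)⁻¹`. -/
lemma IsNTFGenerator.ae_energyDensity_le {n : ℕ} {A : Matrix (Fin n) (Fin n) ℤ}
    {hA : IsDilationMatrix A} {Φ : Set (L2Space n)}
    {V : Submodule ℂ (L2Space n)} [V.HasOrthogonalProjection] (hΦ : IsNTFGenerator Φ V)
    (hV : IsRefinable A hA V) :
    ∀ᵐ w, energyDensity Φ w ≤ energyDensity Φ (matVec ((realMatrix A).transpose⁻¹) w) := by
  have hd := hA.realMatrix_det_ne_zero
  have hB := det_transpose_inv_ne_zero hd
  have hBm := measurable_matVec ((realMatrix A).transpose⁻¹)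
  have hm := measurable_energyDensity hΦ.countable
  -- The projection formula needs T and its image BT each inside a cube, hence the two indices.
  have key (a b : Fin n → ℤ) : ∀ᵐ w ∂(volume.restrict (unitCube fun i => (a i : ℝ))).restrict
      (matVec ((realMatrix A).transpose⁻¹) ⁻¹' unitCube fun i => (b i : ℝ)),
      energyDensity Φ w ≤ energyDensity Φ (matVec ((realMatrix A).transpose⁻¹) w) := by
    refine ae_le_of_forall_setLIntegral_le_of_sigmaFinite hm fun E hE _ => ?_
    have hU := hBm (measurableSet_unitCube fun i => (b i : ℝ))
    rw [Measure.restrict_restrict hE, Measure.restrict_restrict (hE.inter hU)]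
    set T := E ∩ matVec ((realMatrix A).transpose⁻¹) ⁻¹' (unitCube fun i => (b i : ℝ)) ∩
      unitCube fun i => (a i : ℝ) with hTdef
    have hT : MeasurableSet T := (hE.inter hU).inter (measurableSet_unitCube _)
    -- This is BT, written as a preimage under A* so that measurability is immediate.
    set S := matVec (realMatrix A).transpose ⁻¹' T with hSdef
    have hS : MeasurableSet S := measurable_matVec _ hT
    have hdT : (realMatrix A).transpose.det ≠ 0 := by rwa [Matrix.det_transpose]
    have hTS : matVec ((realMatrix A).transpose⁻¹) ⁻¹' S = T := by
      ext w
      simp only [hSdef, Set.mem_preimage]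
      rw [← matVec_mul, Matrix.mul_nonsing_inv _ hdT.isUnit, matVec_one]
    have hSb : S ⊆ unitCube fun i => (b i : ℝ) := by
      intro w hw
      have : matVec ((realMatrix A).transpose⁻¹) (matVec (realMatrix A).transpose w) ∈
        unitCube fun i => (b i : ℝ) := hw.1.2
      rwa [← matVec_mul, Matrix.nonsing_inv_mul _ hdT.isUnit, matVec_one] at this
    have hSf : volume S ≠ ∞ :=
      ((measure_mono hSb).trans_lt (by simp [volume_unitCube])).ne
    have hT' : MeasurableSet (matVec ((realMatrix A).transpose⁻¹) ⁻¹' S) := hBm hS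
    have hTf' := volume_preimage_matVec_ne_top hB hS hSf
    rw [← hTS, setLIntegral_comp_matVec hB hS hm, hΦ.setLIntegral_energyDensity hS hSf hSb,
      hΦ.setLIntegral_energyDensity hT' hTf' (hTS.trans_subset Set.inter_subset_right),
      ← ENNReal.ofReal_mul (by positivity), Matrix.det_nonsing_inv, Matrix.det_transpose,
      Ring.inverse_eq_inv', abs_inv, inv_inv]
    exact ENNReal.ofReal_le_ofReal (hV.norm_starProjection_bandFun_le hS hSf hT' hTf')
  refine ae_of_forall_restrict_unitCube fun a => ?_
  rw [← Measure.restrict_univ (μ := volume.restrict _), ← Set.preimage_univ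
    (f := matVec ((realMatrix A).transpose⁻¹)), ← iUnion_unitCube, Set.preimage_iUnion,
    ae_restrict_iUnion_iff]
  exact key a

end

theorem proposition3p4 {n : ℕ} (A : Matrix (Fin n) (Fin n) ℤ) (hA : IsDilationMatrix A)
    (V₀ : Submodule ℂ (L2Space n)) (hV₀ : IsShiftInvariant V₀) (href : IsRefinable A hA V₀)
    (Φ : Set (L2Space n)) (hΦ : IsNTFGenerator Φ V₀) :
    ∀ᵐ ξ ∂(volume : Measure (EuclideanSpace ℝ (Fin n))),
      (∀ j : ℕ, Summable fun φ : Φ => ‖hatFun (φ : L2Space n) (adjInvPow A j ξ)‖ ^ 2) ∧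
      Monotone fun j : ℕ => ∑' φ : Φ, ‖hatFun (φ : L2Space n) (adjInvPow A j ξ)‖ ^ 2 := by
  have : CompleteSpace V₀ := hV₀.1.completeSpace_coe
  have hB := det_transpose_inv_ne_zero hA.realMatrix_det_ne_zero
  have hc : ((2 * Real.pi)⁻¹ : ℝ) ≠ 0 := by positivity
  -- Null sets pull back to null sets, so the almost-everywhere facts about `𝓕` hold at every
  -- (2π)⁻¹(A*)⁻ʲξ simultaneously.
  have hq (j : ℕ) : Measure.QuasiMeasurePreserving
      (fun ξ => (2 * Real.pi)⁻¹ • adjInvPow A j ξ) (volume : Measure (EuclideanSpace ℝ (Fin n)))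
      volume := by
    refine Measure.QuasiMeasurePreserving.comp (g := fun ξ => (2 * Real.pi)⁻¹ • ξ) ?_
      (matVec_quasiMeasurePreserving (M := ((realMatrix A).transpose⁻¹) ^ j)
        (by rw [Matrix.det_pow]; exact pow_ne_zero _ hB))
    exact ⟨measurable_const_smul _, by
      rw [Measure.map_addHaar_smul volume hc]; exact Measure.smul_absolutelyContinuous⟩
  filter_upwards [ae_all_iff.2 fun j => (hq j).ae hΦ.ae_energyDensity_lt_top,
    ae_all_iff.2 fun j => (hq j).ae (hΦ.ae_energyDensity_le href)] with ξ h1 h2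
  have hE (j : ℕ) (φ : Φ) : ‖hatFun (φ : L2Space n) (adjInvPow A j ξ)‖ ^ 2 =
      (‖(𝓕 (φ : L2Space n) : L2Space n) ((2 * Real.pi)⁻¹ • adjInvPow A j ξ)‖ₑ ^ 2).toReal := by
    rw [ENNReal.toReal_pow, toReal_enorm, hatFun]
  have hsucc (j : ℕ) : adjInvPow A (j + 1) ξ =
      matVec ((realMatrix A).transpose⁻¹) (adjInvPow A j ξ) := by
    rw [adjInvPow, adjInvPow, pow_succ', matVec_mul]
  simp only [hE]
  refine ⟨fun j => ENNReal.summable_toReal (h1 j).ne, monotone_nat_of_le_succ fun j => ?_⟩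
  rw [← ENNReal.tsum_toReal_eq fun φ => by finiteness,
    ← ENNReal.tsum_toReal_eq fun φ => by finiteness]
  refine ENNReal.toReal_mono (h1 (j + 1)).ne ?_
  have := h2 j
  rwa [map_smul, ← hsucc] at this
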